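/- **Theorem 1 (Achievability for Error Metric 1).** For $x\in\mathbb C^M$ let $\mathrm{supp}(x)=\{i: x_i\ne 0\}$ and $\mu(x)=\min_{i\in\mathrm{supp}(x)}|x_i|$. A vector $x\in\mathbb C^M$ is observed through $y=Ax+n$, where $A$ is an $N\times M$ matrix with i.i.d. circularly-symmetric complex Gaussian entries of law $\mathcal N_{\mathbb C}(0,1)$ and $n\sim\mathcal N_{\mathbb C}(0,\nu^2 I_N)$ is independent of $A$, with $\nu>0$. For $L\in\mathbb N$ and $\delta\in\mathbb R$, call $y$ and a set $J\subset\{1,\dots,M\}$ with $|J|=L$ *$\delta$-jointly typical* if the matrix $A_J$ of the columns of $A$ with index in $J$ has rank $L$ and $$\Big|\tfrac1N\|\Pi^{\perp}_{A_J}y\|_2^2-\tfrac{N-L}{N}\nu^2\Big|<\delta ,$$ where $\Pi^\perp_{A_J}$ is the orthogonal projection onto the orthogonal complement of the column span of $A_J$. The $\delta$-joint-typicality decoder $\mathcal D$ outputs the set $J$ with $|J|=L$ that is $\delta$-jointly typical with $y$ if there is exactly one such set, and otherwise declares a failure. Its average error probability (exact support recovery, Error Metric 1) is $p_{\rm err}(\mathcal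 D\mid x)=\mathbb E_A\big[\mathbb P_n(\mathcal D(y)\ne \mathrm{supp}(x))\big]$. For functions $f,g$ of $M$ write $f\succ g$ if either $f=g=0$ identically, or $f$ and $g$ are non-negative and non-decreasing and there is $M_0$ such that $f(M)/g(M)>1$ for all $M>M_0$. Let $\beta>2$ and $L=L(M)=\lfloor M/\beta\rfloor$. There is a constant $C_1>1$ depending only on $\beta$ such that the following holds for every $\nu>0$ and every $\zeta\in(0,1)$. Let $x^{(M)}\in\mathbb C^M$, $M\in\mathbb N$, be a sequence of vectors with $|\mathrm{supp}(x^{(M)})|=L(M)$ for all $M$ and $$\frac{L\,\mu(x^{(M)})^4}{\log L}\to\infty\qquad(M\to\infty),$$ and let the numbers of measurements $N=N(M)$ satisfy $N\succ C_1L$. Then the joint-typicality decoders $\mathcal D=\mathcal D_M$ with threshold $\delta=\zeta\,\mu(x^{(M)})^2\,\frac{N-L}{N}$ achieve asymptotic reliable recovery, $$p_{\rm err}(\mathcal D\mid x^{(M)})\to0 \qquad (M\to\infty),$$ and moreover the error decays faster than every power of $1/L$: $$\frac{-\log p_{\rm err}(\mathcal D\mid x^{(M)})}{\log L}\to\infty\qquad(M\to\infty),$$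 where $-\log 0=\infty$. -/

import Mathlib

open MeasureTheory ProbabilityTheory Filter Topology
open scoped ENNReal NNReal

noncomputable section

namespace SparseRecovery

/-- The circularly-symmetric complex Gaussian law `N_C(0, v)`: real and imaginary parts are
independent real Gaussians with mean `0` and variance `v / 2`, so that `E |z|² = v`. -/
def complexGaussian (v : ℝ≥0) : Measure ℂ :=
  ((gaussianReal 0 (v / 2)).prod (gaussianReal 0 (v / 2))).map
    (fun p : ℝ × ℝ => Complex.mk p.1 p.2)

/-- The law of the array of entries of an `N × M` Gaussian measurement matrix: the entries are
i.i.d. with law `N_C(0, 1)`. -/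
def matrixLaw (N M : ℕ) : Measure (Fin N → Fin M → ℂ) :=
  Measure.pi fun _ : Fin N => Measure.pi fun _ : Fin M => complexGaussian 1

/-- The law `N_C(0, ν² I_N)` of the noise vector. -/
def noiseLaw (ν : ℝ) (N : ℕ) : Measure (Fin N → ℂ) :=
  Measure.pi fun _ : Fin N => complexGaussian (Real.toNNReal (ν ^ 2))

/-- The sparsity `L = ⌊M / β⌋`. -/
def sparsity (β : ℝ) (M : ℕ) : ℕ := ⌊(M : ℝ) / β⌋₊

/-- The support of a vector. -/
def supp {M : ℕ} (x : Fin M → ℂ) : Finset (Fin M) :=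
  open Classical in Finset.univ.filter fun i => x i ≠ 0

/-- `μ(x)`, the smallest modulus of a non-zero coordinate of `x` (an infimum over a finite set,
hence a minimum; `0` by convention if `x = 0`). -/
def minAbs {M : ℕ} (x : Fin M → ℂ) : ℝ := ⨅ i : supp x, ‖x i‖

/-- The noisy observation `y = A x + n`. -/
def observation {N M : ℕ} (A : Matrix (Fin N) (Fin M) ℂ) (x : Fin M → ℂ) (n : Fin N → ℂ) :
    Fin N → ℂ :=
  A.mulVec x + n

/-- `A_J`, the matrix whose columns are the columns of `A` with index in `J`. -/
def columns {N M : ℕ} (A : Matrix (Fin N) (Fin M) ℂ) (J : Finset (Fin M)) :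
    Matrix (Fin N) J ℂ :=
  A.submatrix id Subtype.val

/-- The span of the columns of `A_J`, as a subspace of the Euclidean space `ℂ^N`. -/
def columnSpan {N M : ℕ} (A : Matrix (Fin N) (Fin M) ℂ) (J : Finset (Fin M)) :
    Submodule ℂ (EuclideanSpace ℂ (Fin N)) :=
  Submodule.span ℂ (Set.range fun j : J => WithLp.toLp 2 ((columns A J).col j))

/-- `‖Π^⊥ y‖²`, where `Π^⊥` is the orthogonal projection onto the orthogonal complement of the
span of the columns of `A_J`. -/
def residual {N M : ℕ} (A : Matrix (Fin N) (Fin M) ℂ) (J : Finset (Fin M)) (y : Fin N → ℂ) : ℝ :=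
  ‖(columnSpan A J)ᗮ.starProjection (WithLp.toLp 2 y)‖ ^ 2

/-- `y` and the index set `J` with `|J| = L` are `δ`-jointly typical. -/
def JointlyTypical {N M : ℕ} (ν δ : ℝ) (L : ℕ) (A : Matrix (Fin N) (Fin M) ℂ) (y : Fin N → ℂ)
    (J : Finset (Fin M)) : Prop :=
  J.card = L ∧ (columns A J).rank = L ∧
    |1 / (N : ℝ) * residual A J y - ((N : ℝ) - L) / N * ν ^ 2| < δ

/-- A decoder: from the measurement matrix and the observation it produces a set of indices, or
declares a failure (`none`). -/
abbrev Decoder (N M : ℕ) : Type :=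
  Matrix (Fin N) (Fin M) ℂ → (Fin N → ℂ) → Option (Finset (Fin M))

/-- The joint-typicality decoder: it outputs the index set `J` with `|J| = L` that is `δ`-jointly
typical with `y` if there is exactly one such set, and declares a failure otherwise. -/
def typicalityDecoder (N M : ℕ) (ν δ : ℝ) (L : ℕ) : Decoder N M := fun A y =>
  open Classical in
  if h : ∃! J : Finset (Fin M), JointlyTypical ν δ L A y J then some h.choose else none

/-- `p_err(A | x) = P(D(y) ≠ supp x)`, the probability over the noise that the support is not
recovered exactly, for a given measurement matrix `A`. -/
def errorProbGiven {N M : ℕ} (D : Decoder N M) (ν : ℝ) (x : Fin M → ℂ)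
    (A : Matrix (Fin N) (Fin M) ℂ) : ℝ≥0∞ :=
  noiseLaw ν N {n | D A (observation A x n) ≠ some (supp x)}

/-- `p_err(D | x) = E_A (p_err(A | x))`, the error probability averaged over Gaussian `A`. -/
def errorProb {N M : ℕ} (D : Decoder N M) (ν : ℝ) (x : Fin M → ℂ) : ℝ≥0∞ :=
  ∫⁻ A, errorProbGiven D ν x (Matrix.of A) ∂(matrixLaw N M)

/-- The relation `f ≻ g`. -/
def Dominates (f g : ℕ → ℝ) : Prop :=
  (∀ M, f M = 0 ∧ g M = 0) ∨
    (Monotone f ∧ Monotone g ∧ (∀ M, 0 ≤ f M) ∧ (∀ M, 0 ≤ g M) ∧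
      ∃ M₀ : ℕ, ∀ M > M₀, 1 < f M / g M)

/-- A sequence of decoders achieves asymptotic reliable sparse recovery (Error Metric 1). -/
def AsymptoticallyReliable {N : ℕ → ℕ} (D : ∀ M, Decoder (N M) M) (ν : ℝ)
    (x : ∀ M, Fin M → ℂ) : Prop :=
  Tendsto (fun M => errorProb (D M) ν (x M)) atTop (𝓝 0)

/-- The threshold `δ = ζ μ² (N - L) / N` for joint typicality, where `μ` is the smallest modulus
of a non-zero coordinate of the signal. -/
def threshold (ζ μ : ℝ) (N L : ℕ) : ℝ := ζ * μ ^ 2 * (((N : ℝ) - L) / N)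

end SparseRecovery

end

/-!
Fix `A_J`. Modulo the column span of `A_J`, the observation `A x + n` is a Gaussian vector with
coordinates of variance `σ² = ν² + ∑_{i ∉ J} |x_i|²` which is independent of `A_J`. Hence the
residual is distributed as `σ²` times a sum of `N - L` independent squared moduli of standard
complex Gaussians, and Chernoff's bound applies: it lies below `r σ² (N - L)`, where `r ≤ 1`, with
probability at most `exp (-(N - L) (r - 1 - log r))`.

For `J = supp x` this shows that the support is typical. A competitor `J` that misses `k` elements
of the support has `σ² ≥ ν² + k μ²`, so it is accepted only if the residual is smaller than its
expectation by the factor `(ν² + ζ μ²) / (ν² + k μ²)`. In the union bound over the competitors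
there are two regimes. If `k` is at most of order `L / log L`, there are at most `M ^ (2 k)`
competitors and the exponent is at least a constant multiple of `L min (k μ⁴) 1`, which exceeds
every multiple of `k log L`. If `k` is larger, then the ratio of variances tends to `0`, so the
rate tends to infinity and the exponent exceeds the logarithm of `2 ^ M`.
-/

noncomputable section

namespace SparseRecovery

section ComplexGaussian

lemma measurable_complex_mk : Measurable fun p : ℝ × ℝ => Complex.mk p.1 p.2 :=
  Complex.measurableEquivRealProd.symm.measurable

instance (v : ℝ≥0) : IsProbabilityMeasure (complexGaussian v) :=
  Measure.isProbabilityMeasure_map measurable_complex_mk.aemeasurable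

lemma charFun_complexGaussian (v : ℝ≥0) (t : ℂ) :
    charFun (complexGaussian v) t = Complex.exp (-(v * ‖t‖ ^ 2 / 4 : ℝ)) := by
  have h_inner (p : ℝ × ℝ) : Complex.exp ((inner ℝ (Complex.mk p.1 p.2) t : ℝ) * Complex.I)
      = Complex.exp (t.re * p.1 * Complex.I) * Complex.exp (t.im * p.2 * Complex.I) := by
    rw [← Complex.exp_add, Complex.inner]
    congr 1
    simp only [Complex.mul_re, Complex.conj_re, Complex.conj_im]
    push_cast
    ring
  rw [charFun_apply, complexGaussian,
    integral_map measurable_complex_mk.aemeasurable (by fun_prop)]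
  simp_rw [h_inner]
  rw [integral_prod_mul (fun a : ℝ => Complex.exp (t.re * a * Complex.I))
      (fun b : ℝ => Complex.exp (t.im * b * Complex.I)),
    ← charFun_apply_real, ← charFun_apply_real, charFun_gaussianReal, charFun_gaussianReal,
    ← Complex.exp_add, ← Complex.normSq_eq_norm_sq, Complex.normSq_apply]
  congr 1
  push_cast
  ring

lemma complexGaussian_singleton {v : ℝ≥0} (hv : v ≠ 0) (z : ℂ) : complexGaussian v {z} = 0 := by
  have : NullSingletonClass (gaussianReal 0 (v / 2)) :=
    nullSingletonClass_gaussianReal (div_ne_zero hv two_ne_zero)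
  have h_preimage : (fun p : ℝ × ℝ => Complex.mk p.1 p.2) ⁻¹' {z} = {z.re} ×ˢ {z.im} := by
    ext p
    simp [Complex.ext_iff, Prod.ext_iff]
  rw [complexGaussian, Measure.map_apply measurable_complex_mk (measurableSet_singleton z),
    h_preimage, Measure.prod_prod, measure_singleton, zero_mul]

lemma mgf_sq_gaussianReal {v : ℝ≥0} {t : ℝ} (h : 2 * v * t < 1) :
    mgf (fun a => a ^ 2) (gaussianReal 0 v) t = (√(1 - 2 * v * t))⁻¹ := by
  rcases eq_or_ne v 0 with rfl | hv
  · simp [mgf]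
  have h_density (a : ℝ) : gaussianPDFReal 0 v a • Real.exp (t * a ^ 2)
      = (√(2 * Real.pi * v))⁻¹ * Real.exp (-((1 - 2 * v * t) / (2 * v)) * a ^ 2) := by
    rw [gaussianPDFReal, smul_eq_mul, mul_assoc, ← Real.exp_add]
    congr 2
    field_simp
    ring
  rw [mgf, integral_gaussianReal_eq_integral_smul hv]
  have : (0 : ℝ) < v := by positivity
  simp_rw [h_density]
  rw [integral_const_mul, integral_gaussian, ← Real.sqrt_inv, ← Real.sqrt_mul (by positivity),
    ← Real.sqrt_inv]
  congr 1
  have : 1 - 2 * v * t ≠ 0 := (sub_pos.2 h).ne'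
  field_simp

lemma mgf_norm_sq_complexGaussian {v : ℝ≥0} {t : ℝ} (h : v * t < 1) :
    mgf (fun z => ‖z‖ ^ 2) (complexGaussian v) t = (1 - v * t)⁻¹ := by
  have h_split (p : ℝ × ℝ) : Real.exp (t * ‖Complex.mk p.1 p.2‖ ^ 2)
      = Real.exp (t * p.1 ^ 2) * Real.exp (t * p.2 ^ 2) := by
    rw [← Real.exp_add, ← Complex.normSq_eq_norm_sq, Complex.normSq_apply]
    congr 1
    ring
  have h_var : 2 * ((v / 2 : ℝ≥0) : ℝ) * t = v * t := by push_cast; ring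
  have h_mgf := mgf_sq_gaussianReal (h_var.trans_lt h)
  rw [h_var, mgf] at h_mgf
  rw [mgf, complexGaussian, integral_map measurable_complex_mk.aemeasurable (by fun_prop)]
  simp_rw [h_split]
  rw [integral_prod_mul (fun a : ℝ => Real.exp (t * a ^ 2)) (fun b : ℝ => Real.exp (t * b ^ 2)),
    h_mgf, ← mul_inv, Real.mul_self_sqrt (sub_nonneg.2 h.le)]

lemma measurePreserving_mul_const_complexGaussian (v : ℝ≥0) (c : ℂ) :
    MeasurePreserving (fun z => z * c) (complexGaussian v) (complexGaussian (v * ‖c‖₊ ^ 2)) := by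
  refine ⟨by fun_prop, Measure.ext_of_charFun (funext fun t => ?_)⟩
  have h_inner (z : ℂ) : inner ℝ (z * c) t = inner ℝ z (starRingEnd ℂ c * t) := by
    simp only [Complex.inner, map_mul]
    ring_nf
  rw [charFun_apply, integral_map (by fun_prop) (by fun_prop)]
  simp_rw [h_inner]
  rw [← charFun_apply, charFun_complexGaussian, charFun_complexGaussian]
  simp [mul_pow, mul_assoc]

lemma measurePreserving_add_complexGaussian (v w : ℝ≥0) :
    MeasurePreserving (fun p : ℂ × ℂ => p.1 + p.2)
      ((complexGaussian v).prod (complexGaussian w)) (complexGaussian (v + w)) := by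
  refine ⟨by fun_prop, Measure.ext_of_charFun (funext fun t => ?_)⟩
  rw [← Measure.conv, charFun_conv]
  simp only [charFun_complexGaussian]
  rw [← Complex.exp_add]
  congr 1
  push_cast
  ring

lemma measurePreserving_sum_complexGaussian {ι : Type*} [Fintype ι] (v : ι → ℝ≥0) :
    MeasurePreserving (fun z : ι → ℂ => ∑ i, z i) (Measure.pi fun i => complexGaussian (v i))
      (complexGaussian (∑ i, v i)) := by
  refine ⟨by fun_prop, Measure.ext_of_charFun (funext fun t => ?_)⟩
  rw [iIndepFun.charFun_map_fun_sum_eq_prod (X := fun i (z : ι → ℂ) => z i)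
    (fun i => (measurable_pi_apply i).aemeasurable)
    (iIndepFun_pi (X := fun _ z => z) fun _ => aemeasurable_id), Finset.prod_apply]
  simp only [(measurePreserving_eval (fun i => complexGaussian (v i)) _).map_eq,
    charFun_complexGaussian]
  rw [← Complex.exp_sum]
  congr 1
  push_cast
  rw [Finset.sum_neg_distrib, Finset.sum_mul, Finset.sum_div]

end ComplexGaussian

section GaussianVector

variable {ι : Type*} [Fintype ι]

/-- The law `N_C(0, v I)` of a random vector indexed by `ι` with i.i.d. coordinates of law
`N_C(0, v)`. Both the noise and the rows of the measurement matrix are instances. -/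
def gaussianVector (ι : Type*) [Fintype ι] (v : ℝ≥0) : Measure (ι → ℂ) :=
  Measure.pi fun _ => complexGaussian v

instance (v : ℝ≥0) : IsProbabilityMeasure (gaussianVector ι v) :=
  inferInstanceAs (IsProbabilityMeasure (Measure.pi fun _ => complexGaussian v))

lemma measurePreserving_sum_mul_gaussianVector (v : ℝ≥0) (x : ι → ℂ) :
    MeasurePreserving (fun z => ∑ i, z i * x i) (gaussianVector ι v)
      (complexGaussian (∑ i, v * ‖x i‖₊ ^ 2)) :=
  (measurePreserving_sum_complexGaussian _).comp (measurePreserving_pi _ _ fun i =>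
    measurePreserving_mul_const_complexGaussian v (x i))

lemma measurePreserving_add_gaussianVector (v w : ℝ≥0) :
    MeasurePreserving (fun p : (ι → ℂ) × (ι → ℂ) => p.1 + p.2)
      ((gaussianVector ι v).prod (gaussianVector ι w)) (gaussianVector ι (v + w)) :=
  (measurePreserving_pi _ _ fun _ => measurePreserving_add_complexGaussian v w).comp
    (measurePreserving_arrowProdEquivProdArrow ℂ ℂ ι _ _).symm

lemma charFun_gaussianVector (v : ℝ≥0) (t : EuclideanSpace ℂ ι) :
    charFun ((gaussianVector ι v).map (WithLp.toLp 2)) t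
      = Complex.exp (-(v * ‖t‖ ^ 2 / 4 : ℝ)) := by
  rw [gaussianVector, charFun_pi]
  simp_rw [charFun_complexGaussian]
  rw [← Complex.exp_sum, PiLp.norm_sq_eq_of_L2]
  congr 1
  push_cast
  rw [Finset.sum_neg_distrib, Finset.mul_sum, Finset.sum_div]

lemma inner_real_eq_re_inner_complex (x y : EuclideanSpace ℂ ι) :
    inner ℝ x y = (inner ℂ x y).re := by
  simp only [PiLp.inner_apply, Complex.re_sum]
  rfl

lemma measurePreserving_linearIsometryEquiv_gaussianVector {κ : Type*} [Fintype κ] (v : ℝ≥0)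
    (e : EuclideanSpace ℂ ι ≃ₗᵢ[ℂ] EuclideanSpace ℂ κ) :
    MeasurePreserving (fun z => WithLp.ofLp (e (WithLp.toLp 2 z)))
      (gaussianVector ι v) (gaussianVector κ v) := by
  have hc : Continuous fun z : ι → ℂ => WithLp.ofLp (e (WithLp.toLp 2 z)) := by fun_prop
  have h_adjoint (x : EuclideanSpace ℂ ι) (t : EuclideanSpace ℂ κ) :
      inner ℝ (e x) t = inner ℝ x (e.symm t) := by
    rw [inner_real_eq_re_inner_complex, inner_real_eq_re_inner_complex,
      LinearIsometryEquiv.inner_map_eq_flip]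
  have := Measure.isProbabilityMeasure_map (μ := gaussianVector ι v) hc.aemeasurable
  refine ⟨hc.measurable, charFun_eq_pi_iff.1 fun t => ?_⟩
  rw [← charFun_pi, ← gaussianVector, charFun_gaussianVector, ← e.symm.norm_map t,
    ← charFun_gaussianVector, Measure.map_map (by fun_prop) hc.measurable, charFun_apply,
    charFun_apply, integral_map (by fun_prop) (by fun_prop),
    integral_map (by fun_prop) (by fun_prop)]
  simp_rw [← h_adjoint]
  rfl

end GaussianVector

section Projection

variable {𝕜 E ι : Type*} [RCLike 𝕜] [NormedAddCommGroup E] [InnerProductSpace 𝕜 E]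
  [FiniteDimensional 𝕜 E] [Fintype ι]

lemma exists_orthonormalBasis_extending (K : Submodule 𝕜 E)
    (hι : Module.finrank 𝕜 E = Fintype.card ι) :
    ∃ (b : OrthonormalBasis ι 𝕜 E) (s : Finset ι) (u : OrthonormalBasis s 𝕜 K),
      s.card = Module.finrank 𝕜 K ∧ ∀ i : s, b i = u i := by
  classical
  obtain ⟨s, -, hs⟩ := Finset.exists_subset_card_eq (s := (Finset.univ : Finset ι))
    ((Submodule.finrank_le K).trans hι.le)
  let u : OrthonormalBasis s 𝕜 K := (stdOrthonormalBasis 𝕜 K).reindex (s.equivFinOfCardEq hs).symm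
  let w : ι → E := fun i => if hi : i ∈ s then u ⟨i, hi⟩ else 0
  have hw (i : s) : w i = u i := dif_pos i.2
  have h_orthonormal : Orthonormal 𝕜 ((s : Set ι).domRestrict w) := by
    convert! u.orthonormal.comp_linearIsometry K.subtypeₗᵢ using 1
    exact funext hw
  obtain ⟨b, hb⟩ := h_orthonormal.exists_orthonormalBasis_extension_of_card_eq hι
  exact ⟨b, s, u, hs, fun i => (hb i i.2).trans (hw i)⟩

lemma exists_norm_starProjection_sq_eq_sum (K : Submodule 𝕜 E)
    (hι : Module.finrank 𝕜 E = Fintype.card ι) :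
    ∃ (b : OrthonormalBasis ι 𝕜 E) (s : Finset ι), s.card = Module.finrank 𝕜 K ∧
      ∀ z, ‖K.starProjection z‖ ^ 2 = ∑ i ∈ s, ‖b.repr z i‖ ^ 2 := by
  obtain ⟨b, s, u, hs, hb⟩ := exists_orthonormalBasis_extending K hι
  refine ⟨b, s, hs, fun z => ?_⟩
  rw [Submodule.starProjection_apply, ← Submodule.coe_norm, ← u.sum_sq_norm_inner_right,
    ← Finset.sum_coe_sort s]
  refine Finset.sum_congr rfl fun i _ => ?_
  rw [Submodule.inner_orthogonalProjectionOnto_eq_of_mem_left, b.repr_apply_apply, hb i]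

end Projection

section ProjectionLaw

lemma mgf_comp_of_measurePreserving {Ω Ω' : Type*} [MeasurableSpace Ω] [MeasurableSpace Ω']
    {μ : Measure Ω} {μ' : Measure Ω'} {f : Ω → Ω'} {X : Ω' → ℝ} {t : ℝ}
    (hf : MeasurePreserving f μ μ') (hX : Measurable X) :
    mgf (fun ω => X (f ω)) μ t = mgf X μ' t := by
  rw [← hf.map_eq, mgf_map hf.measurable.aemeasurable (by fun_prop)]
  rfl

variable {ι : Type*} [Fintype ι]

lemma mgf_sum_norm_sq_gaussianVector {v : ℝ≥0} {t : ℝ} (h : v * t < 1) (s : Finset ι) :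
    mgf (fun z => ∑ i ∈ s, ‖z i‖ ^ 2) (gaussianVector ι v) t = (1 - v * t)⁻¹ ^ s.card := by
  have h_indep : iIndepFun (fun i (z : ι → ℂ) => ‖z i‖ ^ 2) (gaussianVector ι v) :=
    iIndepFun_pi (X := fun _ (z : ℂ) => ‖z‖ ^ 2) fun _ => by fun_prop
  have h_mgf (i : ι) : mgf (fun z => ‖z i‖ ^ 2) (gaussianVector ι v) t = (1 - v * t)⁻¹ :=
    (mgf_comp_of_measurePreserving (X := fun z => ‖z‖ ^ 2) (measurePreserving_eval _ i)
      (by fun_prop)).trans (mgf_norm_sq_complexGaussian h)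
  calc mgf (fun z => ∑ i ∈ s, ‖z i‖ ^ 2) (gaussianVector ι v) t
      = mgf (∑ i ∈ s, fun z => ‖z i‖ ^ 2) (gaussianVector ι v) t := by
        congr 1
        ext z
        rw [Finset.sum_apply]
    _ = ∏ i ∈ s, mgf (fun z => ‖z i‖ ^ 2) (gaussianVector ι v) t :=
        h_indep.mgf_sum (fun i => by fun_prop) s
    _ = (1 - v * t)⁻¹ ^ s.card := Finset.prod_eq_pow_card fun i _ => h_mgf i

lemma mgf_norm_starProjection_sq_gaussianVector {v : ℝ≥0} {t : ℝ} (h : v * t < 1)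
    (K : Submodule ℂ (EuclideanSpace ℂ ι)) :
    mgf (fun z => ‖K.starProjection (WithLp.toLp 2 z)‖ ^ 2) (gaussianVector ι v) t
      = (1 - v * t)⁻¹ ^ Module.finrank ℂ K := by
  obtain ⟨b, s, hs, h_norm⟩ := exists_norm_starProjection_sq_eq_sum (ι := ι) K (by simp)
  simp_rw [h_norm]
  rw [← hs, ← mgf_sum_norm_sq_gaussianVector h s]
  exact mgf_comp_of_measurePreserving
    (measurePreserving_linearIsometryEquiv_gaussianVector v b.repr)
    (X := fun z => ∑ i ∈ s, ‖z i‖ ^ 2) (by fun_prop)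

end ProjectionLaw

section ChiSquareTail

/-- The large deviation rate function of the mean of i.i.d. exponential variables of mean `1`,
that is, of a normalized chi-square variable with an even number of degrees of freedom. -/
def rate (r : ℝ) : ℝ := r - 1 - Real.log r

lemma sq_sqrt_sub_one_le_rate {r : ℝ} (hr : 0 < r) : (√r - 1) ^ 2 ≤ rate r := by
  have h_log : Real.log r = 2 * Real.log √r := by rw [Real.log_sqrt hr.le]; ring
  have h_le := Real.log_le_sub_one_of_pos (Real.sqrt_pos.2 hr)
  rw [rate, h_log]
  linarith [Real.sq_sqrt hr.le]

lemma sq_sub_one_div_six_le_rate {r : ℝ} (hr : 0 < r) (hr2 : r ≤ 2) : (r - 1) ^ 2 / 6 ≤ rate r := by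
  have h_sqrt : √r ≤ 1.42 := Real.sqrt_le_iff.2 ⟨by norm_num, by linarith⟩
  have h_factor : r - 1 = (√r - 1) * (√r + 1) := by linarith [Real.sq_sqrt hr.le]
  have : (√r + 1) ^ 2 ≤ 6 := by nlinarith [Real.sqrt_nonneg r]
  calc (r - 1) ^ 2 / 6 = (√r - 1) ^ 2 * ((√r + 1) ^ 2 / 6) := by rw [h_factor]; ring
    _ ≤ (√r - 1) ^ 2 := mul_le_of_le_one_right (sq_nonneg _) (by linarith)
    _ ≤ rate r := sq_sqrt_sub_one_le_rate hr

lemma log_sub_one_le_rate {r E : ℝ} (hr : 0 < r) (h : r ≤ E⁻¹) : Real.log E - 1 ≤ rate r := by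
  have h_log := Real.log_le_log hr h
  rw [Real.log_inv] at h_log
  rw [rate]
  linarith

lemma exp_mul_pow_eq_exp_neg_rate {r : ℝ} (hr : 0 < r) (d : ℕ) :
    Real.exp ((1 - r) * d) * r ^ d = Real.exp (-(d * rate r)) := by
  rw [← Real.exp_log (pow_pos hr d), Real.log_pow, ← Real.exp_add, rate]
  congr 1
  ring

variable {ι : Type*} [Fintype ι] {v : ℝ≥0} {r : ℝ} (K : Submodule ℂ (EuclideanSpace ℂ ι))

lemma integrable_exp_norm_starProjection_sq {t : ℝ} (h : v * t < 1) :
    Integrable (fun z => Real.exp (t * ‖K.starProjection (WithLp.toLp 2 z)‖ ^ 2))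
      (gaussianVector ι v) := by
  by_contra h_int
  have h_pos : 0 < (1 - v * t)⁻¹ ^ Module.finrank ℂ K :=
    pow_pos (inv_pos.2 (sub_pos.2 h)) _
  exact h_pos.ne' ((mgf_norm_starProjection_sq_gaussianVector h K).symm.trans (mgf_undef h_int))

-- The exponent `t = (1 - r⁻¹) / v` optimizes the Chernoff bound at level `r` times the mean.
lemma exp_mul_mgf_norm_starProjection_sq (hv : v ≠ 0) (hr : 0 < r) :
    Real.exp (-((1 - r⁻¹) / v) * (r * (Module.finrank ℂ K * v))) *
      mgf (fun z => ‖K.starProjection (WithLp.toLp 2 z)‖ ^ 2) (gaussianVector ι v)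
        ((1 - r⁻¹) / v) = Real.exp (-(Module.finrank ℂ K * rate r)) := by
  have hv' : (v : ℝ) ≠ 0 := NNReal.coe_ne_zero.2 hv
  have h_one_sub : 1 - v * ((1 - r⁻¹) / v) = r⁻¹ := by field_simp; ring
  rw [mgf_norm_starProjection_sq_gaussianVector (by linarith [inv_pos.2 hr]), h_one_sub, inv_inv,
    ← exp_mul_pow_eq_exp_neg_rate hr]
  congr 2
  field_simp
  ring

lemma measureReal_norm_starProjection_sq_le (hv : v ≠ 0) (hr : 0 < r) (hr1 : r ≤ 1) :
    (gaussianVector ι v).real {z | ‖K.starProjection (WithLp.toLp 2 z)‖ ^ 2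
        ≤ r * (Module.finrank ℂ K * v)} ≤ Real.exp (-(Module.finrank ℂ K * rate r)) := by
  rw [← exp_mul_mgf_norm_starProjection_sq K hv hr]
  refine measure_le_le_exp_mul_mgf _ (div_nonpos_of_nonpos_of_nonneg ?_ v.2)
    (integrable_exp_norm_starProjection_sq K ?_)
  · linarith [(one_le_inv₀ hr).2 hr1]
  · rw [mul_div_cancel₀ _ (NNReal.coe_ne_zero.2 hv)]
    linarith [inv_pos.2 hr]

lemma measureReal_le_norm_starProjection_sq (hv : v ≠ 0) (hr : 1 ≤ r) :
    (gaussianVector ι v).real {z | r * (Module.finrank ℂ K * v)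
        ≤ ‖K.starProjection (WithLp.toLp 2 z)‖ ^ 2}
      ≤ Real.exp (-(Module.finrank ℂ K * rate r)) := by
  have hr0 : 0 < r := one_pos.trans_le hr
  rw [← exp_mul_mgf_norm_starProjection_sq K hv hr0]
  refine measure_ge_le_exp_mul_mgf _ (div_nonneg ?_ v.2)
    (integrable_exp_norm_starProjection_sq K ?_)
  · linarith [inv_le_one_of_one_le₀ hr]
  · rw [mul_div_cancel₀ _ (NNReal.coe_ne_zero.2 hv)]
    linarith [inv_pos.2 hr0]

lemma measureReal_abs_norm_starProjection_sq_sub (hv : v ≠ 0) {u : ℝ} (hu : 0 ≤ u) (hu1 : u < 1) :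
    (gaussianVector ι v).real {z | u * (Module.finrank ℂ K * v)
        ≤ |‖K.starProjection (WithLp.toLp 2 z)‖ ^ 2 - Module.finrank ℂ K * v|}
      ≤ 2 * Real.exp (-(Module.finrank ℂ K * (u ^ 2 / 6))) := by
  set d : ℝ := (Module.finrank ℂ K : ℝ)
  let X (z : ι → ℂ) : ℝ := ‖K.starProjection (WithLp.toLp 2 z)‖ ^ 2
  have h_subset : {z | u * (d * v) ≤ |X z - d * v|}
      ⊆ {z | X z ≤ (1 - u) * (d * v)} ∪ {z | (1 + u) * (d * v) ≤ X z} := by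
    intro z (hz : u * (d * v) ≤ |X z - d * v|)
    rcases le_abs'.1 hz with h | h
    · exact Or.inl (show X z ≤ (1 - u) * (d * v) by linarith)
    · exact Or.inr (show (1 + u) * (d * v) ≤ X z by linarith)
  have h_exp {r : ℝ} (hr : 0 < r) (hr2 : r ≤ 2) (hru : (r - 1) ^ 2 = u ^ 2) :
      Real.exp (-(d * rate r)) ≤ Real.exp (-(d * (u ^ 2 / 6))) := by
    rw [← hru]
    gcongr
    exact sq_sub_one_div_six_le_rate hr hr2
  calc _ ≤ (gaussianVector ι v).real {z | X z ≤ (1 - u) * (d * v)}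
        + (gaussianVector ι v).real {z | (1 + u) * (d * v) ≤ X z} :=
        (measureReal_mono h_subset).trans (measureReal_union_le _ _)
    _ ≤ Real.exp (-(d * rate (1 - u))) + Real.exp (-(d * rate (1 + u))) :=
        add_le_add (measureReal_norm_starProjection_sq_le K hv (by linarith) (by linarith))
          (measureReal_le_norm_starProjection_sq K hv (by linarith))
    _ ≤ Real.exp (-(d * (u ^ 2 / 6))) + Real.exp (-(d * (u ^ 2 / 6))) :=
        add_le_add (h_exp (by linarith) (by linarith) (by ring))
          (h_exp (by linarith) (by linarith) (by ring))
    _ = 2 * Real.exp (-(d * (u ^ 2 / 6))) := (two_mul _).symm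

end ChiSquareTail

section ColumnSpan

variable {ι κ : Type*}

/-- The span of the columns of a matrix, as a subspace of Euclidean space; `columnSpan A J` is
`colSpan (columns A J)` by definition. -/
def colSpan (B : Matrix ι κ ℂ) : Submodule ℂ (EuclideanSpace ℂ ι) :=
  Submodule.span ℂ (Set.range fun j => WithLp.toLp 2 (B.col j))

lemma mem_colSpan_iff [Fintype κ] {B : Matrix ι κ ℂ} {w : EuclideanSpace ℂ ι} :
    w ∈ colSpan B ↔ ∃ c : κ → ℂ, WithLp.toLp 2 (B.mulVec c) = w := by
  rw [colSpan, Submodule.mem_span_range_iff_exists_fun]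
  refine exists_congr fun c => ?_
  have h_sum : ∑ i, c i • WithLp.toLp 2 (B.col i) = WithLp.toLp 2 (B.mulVec c) := by
    ext r
    simp [Matrix.mulVec, dotProduct, Matrix.col, mul_comm]
  rw [h_sum]

lemma finrank_colSpan [Fintype κ] (B : Matrix ι κ ℂ) : Module.finrank ℂ (colSpan B) = B.rank := by
  rw [Matrix.rank_eq_finrank_span_cols, colSpan,
    ← LinearEquiv.finrank_map_eq (WithLp.linearEquiv 2 ℂ (ι → ℂ)), Submodule.map_span,
    ← Set.range_comp]
  rfl

lemma rank_eq_card_of_notMem_colSpan [Fintype κ] [DecidableEq κ] {B : Matrix ι κ ℂ}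
    (h : ∀ j, WithLp.toLp 2 (B.col j)
      ∉ colSpan (B.submatrix id (Subtype.val : ({j}ᶜ : Finset κ) → κ))) :
    B.rank = Fintype.card κ := by
  rw [← finrank_colSpan, colSpan, finrank_span_eq_card]
  refine linearIndependent_iff_notMem_span.2 fun j hj => h j (Submodule.span_mono ?_ hj)
  rintro _ ⟨i, hi, rfl⟩
  exact ⟨⟨i, by simpa using hi⟩, rfl⟩

variable [Fintype ι]

/-- The squared distance of a vector to the span of the columns of a matrix; `residual A J y` is
`distSqColSpan (columns A J) y` by definition. -/
def distSqColSpan (B : Matrix ι κ ℂ) (w : ι → ℂ) : ℝ :=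
  ‖(colSpan B)ᗮ.starProjection (WithLp.toLp 2 w)‖ ^ 2

lemma distSqColSpan_eq_zero_iff {B : Matrix ι κ ℂ} {w : ι → ℂ} :
    distSqColSpan B w = 0 ↔ WithLp.toLp 2 w ∈ colSpan B := by
  rw [distSqColSpan, sq_eq_zero_iff, norm_eq_zero, Submodule.starProjection_apply_eq_zero_iff,
    Submodule.orthogonal_orthogonal]

lemma distSqColSpan_eq_iInf [Fintype κ] (B : Matrix ι κ ℂ) (w : ι → ℂ) :
    distSqColSpan B w = (⨅ c : κ → ℂ, ‖WithLp.toLp 2 (w - B.mulVec c)‖) ^ 2 := by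
  have h_surj : Function.Surjective fun c : κ → ℂ =>
      (⟨WithLp.toLp 2 (B.mulVec c), mem_colSpan_iff.2 ⟨c, rfl⟩⟩ : colSpan B) := by
    rintro ⟨w, hw⟩
    obtain ⟨c, hc⟩ := mem_colSpan_iff.1 hw
    exact ⟨c, Subtype.ext hc⟩
  rw [distSqColSpan, Submodule.starProjection_orthogonal_val, Submodule.starProjection_minimal,
    ← h_surj.iInf_comp]
  rfl

lemma measurable_distSqColSpan [Finite κ] : Measurable fun p : (ι → κ → ℂ) × (ι → ℂ) =>
    distSqColSpan (Matrix.of p.1) p.2 := by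
  cases nonempty_fintype κ
  -- The infimum over the coefficients is uncountable, but it is upper semicontinuous.
  simp_rw [distSqColSpan_eq_iInf]
  refine Measurable.pow_const (UpperSemicontinuous.measurable ?_) 2
  refine upperSemicontinuous_ciInf (fun p => ⟨0, ?_⟩) fun c => Continuous.upperSemicontinuous ?_
  · rintro _ ⟨c, rfl⟩
    positivity
  · have : Continuous fun p : (ι → κ → ℂ) × (ι → ℂ) => p.2 - (Matrix.of p.1).mulVec c :=
      continuous_snd.sub (Continuous.matrix_mulVec (A := fun p : (ι → κ → ℂ) × (ι → ℂ) =>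
        Matrix.of p.1) continuous_fst continuous_const)
    fun_prop

lemma distSqColSpan_mulVec_add [Fintype κ] (B : Matrix ι κ ℂ) (c : κ → ℂ) (w : ι → ℂ) :
    distSqColSpan B (B.mulVec c + w) = distSqColSpan B w := by
  have h_zero : (colSpan B)ᗮ.starProjection (WithLp.toLp 2 (B.mulVec c)) = 0 := by
    rw [Submodule.starProjection_apply_eq_zero_iff, Submodule.orthogonal_orthogonal]
    exact mem_colSpan_iff.2 ⟨c, rfl⟩
  rw [distSqColSpan, WithLp.toLp_add, map_add, h_zero, zero_add, distSqColSpan]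

lemma finrank_colSpan_orthogonal [Fintype κ] (B : Matrix ι κ ℂ) :
    Module.finrank ℂ (colSpan B)ᗮ = Fintype.card ι - B.rank := by
  have h_add := Submodule.finrank_add_finrank_orthogonal (colSpan B)
  rw [finrank_euclideanSpace, finrank_colSpan] at h_add
  exact Nat.eq_sub_of_add_eq' h_add

end ColumnSpan

section GaussianMatrix

variable {ι κ : Type*} [Fintype ι] [Fintype κ]

/-- The law of a random matrix with i.i.d. entries of law `N_C(0, 1)`; the columns of such a matrix
with index in a subset have a law of the same form. -/
def gaussianMatrix (ι κ : Type*) [Fintype ι] [Fintype κ] : Measure (ι → κ → ℂ) :=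
  Measure.pi fun _ => gaussianVector κ 1

instance : IsProbabilityMeasure (gaussianMatrix ι κ) :=
  inferInstanceAs (IsProbabilityMeasure (Measure.pi fun _ => gaussianVector κ 1))

lemma ae_notMem_of_ne_top {v : ℝ≥0} (hv : v ≠ 0) {K : Submodule ℂ (EuclideanSpace ℂ ι)}
    (hK : K ≠ ⊤) : ∀ᵐ z ∂gaussianVector ι v, WithLp.toLp 2 z ∉ K := by
  obtain ⟨w, hwK, hw⟩ := Submodule.exists_mem_ne_zero_of_ne_bot
    (mt (Submodule.orthogonal_eq_bot_iff).1 hK)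
  have h_var : ∑ i, v * ‖starRingEnd ℂ (w i)‖₊ ^ 2 ≠ 0 := fun h =>
    hw (PiLp.ext fun i => by simpa [hv] using Finset.sum_eq_zero_iff.1 h i (Finset.mem_univ i))
  have h_law := measurePreserving_sum_mul_gaussianVector v fun i => starRingEnd ℂ (w i)
  have h_ae := h_law.quasiMeasurePreserving.ae
    (measure_eq_zero_iff_ae_notMem.1 (complexGaussian_singleton h_var 0))
  filter_upwards [h_ae] with z hz hzK
  refine hz ?_
  have := (Submodule.mem_orthogonal' K w).1 hwK _ hzK
  simpa [PiLp.inner_apply] using this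

/-- The contribution `∑_{i ∉ s} x_i A_i` to `A x` of the columns of `A` with index outside `s`. -/
def outerPart [DecidableEq κ] (s : Finset κ) (x : κ → ℂ) (A : ι → κ → ℂ) : ι → ℂ :=
  fun r => ∑ i ∈ sᶜ, A r i * x i

lemma measurePreserving_restrict_sum_compl [DecidableEq κ] (s : Finset κ) (x : κ → ℂ) :
    MeasurePreserving (fun z : κ → ℂ => ((fun j : s => z j), ∑ i ∈ sᶜ, z i * x i))
      (gaussianVector κ 1)
      ((gaussianVector s 1).prod (complexGaussian (∑ i ∈ sᶜ, ‖x i‖₊ ^ 2))) := by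
  have h_split : MeasurePreserving (MeasurableEquiv.piEquivPiSubtypeProd (fun _ : κ => ℂ) (· ∈ s))
      (gaussianVector κ 1) ((gaussianVector s 1).prod (gaussianVector {i // i ∉ s} 1)) := by
    convert! measurePreserving_piEquivPiSubtypeProd (fun _ : κ => complexGaussian 1) (· ∈ s)
    rw [gaussianVector]
    congr!
  have h_sum := measurePreserving_sum_mul_gaussianVector 1 fun i : {i // i ∉ s} => x i
  have h_compl (i : κ) : i ∈ sᶜ ↔ i ∉ s := Finset.mem_compl
  simp only [one_mul, ← Finset.sum_subtype sᶜ h_compl fun i => ‖x i‖₊ ^ 2] at h_sum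
  convert! ((MeasurePreserving.id (gaussianVector s 1)).prod h_sum).comp h_split using 2 with z
  exact congrArg _ (Finset.sum_subtype sᶜ h_compl fun i => z i * x i)

lemma measurePreserving_submatrix_outerPart [DecidableEq κ] (s : Finset κ) (x : κ → ℂ) :
    MeasurePreserving (fun A : ι → κ → ℂ => ((fun r (j : s) => A r j), outerPart s x A))
      (gaussianMatrix ι κ)
      ((gaussianMatrix ι s).prod (gaussianVector ι (∑ i ∈ sᶜ, ‖x i‖₊ ^ 2))) :=
  (measurePreserving_arrowProdEquivProdArrow (s → ℂ) ℂ ι _ _).comp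
    (measurePreserving_pi _ _ fun _ => measurePreserving_restrict_sum_compl s x)

lemma measurePreserving_submatrix_outerPart_add [DecidableEq κ] (s : Finset κ) (x : κ → ℂ)
    (v : ℝ≥0) :
    MeasurePreserving
      (fun p : (ι → κ → ℂ) × (ι → ℂ) => ((fun r (j : s) => p.1 r j), outerPart s x p.1 + p.2))
      ((gaussianMatrix ι κ).prod (gaussianVector ι v))
      ((gaussianMatrix ι s).prod (gaussianVector ι (∑ i ∈ sᶜ, ‖x i‖₊ ^ 2 + v))) :=
  ((MeasurePreserving.id _).prod (measurePreserving_add_gaussianVector _ v)).comp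
    ((measurePreserving_prodAssoc _ _ _).comp
      ((measurePreserving_submatrix_outerPart s x).prod (MeasurePreserving.id _)))

lemma ae_col_notMem_colSpan {s : Finset κ} {j : κ} (hj : j ∉ s) (hs : s.card < Fintype.card ι) :
    ∀ᵐ A ∂gaussianMatrix ι κ, WithLp.toLp 2 ((Matrix.of A).col j)
      ∉ colSpan ((Matrix.of A).submatrix id (Subtype.val : s → κ)) := by
  classical
  let x : κ → ℂ := Pi.single j 1
  have h_var : ∑ i ∈ sᶜ, ‖x i‖₊ ^ 2 ≠ 0 := fun h => by
    simpa [x] using Finset.sum_eq_zero_iff.1 h j (Finset.mem_compl.2 hj)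
  have h_outer (A : ι → κ → ℂ) : outerPart s x A = (Matrix.of A).col j := by
    ext r
    simp [outerPart, x, Pi.single_apply, hj]
  have h_prod : ∀ᵐ p ∂(gaussianMatrix ι s).prod (gaussianVector ι (∑ i ∈ sᶜ, ‖x i‖₊ ^ 2)),
      distSqColSpan (Matrix.of p.1) p.2 ≠ 0 := by
    refine Measure.ae_prod_iff_ae_ae
      (measurable_distSqColSpan (measurableSet_singleton 0).compl) |>.2 (ae_of_all _ fun B => ?_)
    have h_ne_top : colSpan (Matrix.of B) ≠ ⊤ := fun h_top => by
      have h_rank := finrank_colSpan (Matrix.of B)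
      rw [h_top, finrank_top, finrank_euclideanSpace] at h_rank
      have h_le := (Matrix.of B).rank_le_card_width
      rw [Fintype.card_coe] at h_le
      exact (h_rank.le.trans h_le).not_gt hs
    filter_upwards [ae_notMem_of_ne_top h_var h_ne_top] with w hw
    exact mt distSqColSpan_eq_zero_iff.1 hw
  filter_upwards [(measurePreserving_submatrix_outerPart s x).quasiMeasurePreserving.ae h_prod]
    with A hA
  rw [← h_outer, ← distSqColSpan_eq_zero_iff]
  exact hA

lemma ae_rank_gaussianMatrix (h : Fintype.card κ ≤ Fintype.card ι) :
    ∀ᵐ B ∂gaussianMatrix ι κ, (Matrix.of B).rank = Fintype.card κ := by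
  classical
  have h_ae : ∀ᵐ B ∂gaussianMatrix ι κ, ∀ j, WithLp.toLp 2 ((Matrix.of B).col j)
      ∉ colSpan ((Matrix.of B).submatrix id (Subtype.val : ({j}ᶜ : Finset κ) → κ)) :=
    ae_all_iff.2 fun j => ae_col_notMem_colSpan (by simp)
      ((Finset.card_lt_univ_of_notMem (x := j) (by simp)).trans_le h)
  filter_upwards [h_ae] with B hB using rank_eq_card_of_notMem_colSpan hB

end GaussianMatrix

section ResidualLaw

variable {N M : ℕ}

/-- The joint law of the entries of the measurement matrix and of the noise vector. -/
def sampleLaw (ν : ℝ) (N M : ℕ) : Measure ((Fin N → Fin M → ℂ) × (Fin N → ℂ)) :=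
  (gaussianMatrix (Fin N) (Fin M)).prod (gaussianVector (Fin N) (Real.toNNReal (ν ^ 2)))

instance (ν : ℝ) : IsProbabilityMeasure (sampleLaw ν N M) := by
  unfold sampleLaw
  infer_instance

/-- The residual `‖Π^⊥ y‖²` of the observation `y = A x + n` as a random variable, that is, as a
function of the matrix `A` and the noise `n`. -/
def observedResidual (J : Finset (Fin M)) (x : Fin M → ℂ)
    (p : (Fin N → Fin M → ℂ) × (Fin N → ℂ)) : ℝ :=
  residual (Matrix.of p.1) J (observation (Matrix.of p.1) x p.2)

/-- The variance of the coordinates of the part of the observation that does not come from the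
columns with index in `J`. -/
def outerVariance (ν : ℝ) (J : Finset (Fin M)) (x : Fin M → ℂ) : ℝ≥0 :=
  ∑ i ∈ Jᶜ, ‖x i‖₊ ^ 2 + Real.toNNReal (ν ^ 2)

lemma observedResidual_eq_distSqColSpan (J : Finset (Fin M)) (x : Fin M → ℂ)
    (p : (Fin N → Fin M → ℂ) × (Fin N → ℂ)) :
    observedResidual J x p
      = distSqColSpan (Matrix.of fun r (j : J) => p.1 r j) (outerPart J x p.1 + p.2) := by
  have h_split : observation (Matrix.of p.1) x p.2
      = (columns (Matrix.of p.1) J).mulVec (fun j => x j) + (outerPart J x p.1 + p.2) := by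
    rw [observation, ← add_assoc]
    congr 1
    ext r
    change ∑ i, p.1 r i * x i = ∑ j : J, p.1 r j * x j + ∑ i ∈ Jᶜ, p.1 r i * x i
    rw [Finset.sum_coe_sort J fun i => p.1 r i * x i, Finset.sum_add_sum_compl]
  rw [observedResidual, h_split]
  exact distSqColSpan_mulVec_add _ _ _

lemma measurable_observedResidual (J : Finset (Fin M)) (x : Fin M → ℂ) :
    Measurable (observedResidual (N := N) J x) := by
  have h_parts : Measurable fun p : (Fin N → Fin M → ℂ) × (Fin N → ℂ) =>
      ((fun r (j : J) => p.1 r j), outerPart J x p.1 + p.2) := by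
    unfold outerPart
    fun_prop
  simpa only [Function.comp_def, ← observedResidual_eq_distSqColSpan] using
    measurable_distSqColSpan.comp h_parts

lemma ae_rank_columns {J : Finset (Fin M)} (hJ : J.card ≤ N) :
    ∀ᵐ A ∂matrixLaw N M, (columns (Matrix.of A) J).rank = J.card := by
  have h_rank := ae_rank_gaussianMatrix (ι := Fin N) (κ := J) (by simpa using hJ)
  rw [Fintype.card_coe] at h_rank
  exact ((measurePreserving_fst.comp
    (measurePreserving_submatrix_outerPart J 0)).quasiMeasurePreserving.ae h_rank)

-- Given `A_J`, the observation modulo the column span of `A_J` is a Gaussian vector independent of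
-- that span, so the residual inherits every bound valid for projections on fixed subspaces.
lemma measureReal_observedResidual_mem_le {J : Finset (Fin M)} (hJ : J.card ≤ N) (x : Fin M → ℂ)
    (ν : ℝ) {S : Set ℝ} (hS : MeasurableSet S) {b : ℝ}
    (h : ∀ K : Submodule ℂ (EuclideanSpace ℂ (Fin N)), Module.finrank ℂ K = N - J.card →
      (gaussianVector (Fin N) (outerVariance ν J x)).real
        {z | ‖K.starProjection (WithLp.toLp 2 z)‖ ^ 2 ∈ S} ≤ b) :
    (sampleLaw ν N M).real {p | observedResidual J x p ∈ S} ≤ b := by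
  let T : Set ((Fin N → J → ℂ) × (Fin N → ℂ)) := {q | distSqColSpan (Matrix.of q.1) q.2 ∈ S}
  have hT : MeasurableSet T := measurable_distSqColSpan hS
  have h_section : ∀ᵐ B ∂gaussianMatrix (Fin N) J,
      gaussianVector (Fin N) (outerVariance ν J x) (Prod.mk B ⁻¹' T) ≤ ENNReal.ofReal b := by
    filter_upwards [ae_rank_gaussianMatrix (ι := Fin N) (κ := J) (by simpa using hJ)] with B hB
    rw [← ofReal_measureReal]
    refine ENNReal.ofReal_le_ofReal (h (colSpan (Matrix.of B))ᗮ ?_)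
    rw [finrank_colSpan_orthogonal, hB, Fintype.card_fin, Fintype.card_coe]
  have h_measure : sampleLaw ν N M {p | observedResidual J x p ∈ S} ≤ ENNReal.ofReal b := by
    simp_rw [observedResidual_eq_distSqColSpan]
    calc _ = (gaussianMatrix (Fin N) J).prod (gaussianVector (Fin N) (outerVariance ν J x)) T :=
          (measurePreserving_submatrix_outerPart_add J x _).measure_preimage hT.nullMeasurableSet
      _ = ∫⁻ B, gaussianVector (Fin N) (outerVariance ν J x) (Prod.mk B ⁻¹' T)
            ∂gaussianMatrix (Fin N) J := Measure.prod_apply hT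
      _ ≤ ∫⁻ _, ENNReal.ofReal b ∂gaussianMatrix (Fin N) J := lintegral_mono_ae h_section
      _ = ENNReal.ofReal b := by simp
  have hb : 0 ≤ b := by
    obtain ⟨B, hB⟩ := (ae_rank_gaussianMatrix (ι := Fin N) (κ := J) (by simpa using hJ)).exists
    refine measureReal_nonneg.trans (h (colSpan (Matrix.of B))ᗮ ?_)
    rw [finrank_colSpan_orthogonal, hB, Fintype.card_fin, Fintype.card_coe]
  exact ENNReal.toReal_le_of_le_ofReal hb h_measure

variable {J : Finset (Fin M)} {x : Fin M → ℂ} {ν : ℝ}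

lemma measureReal_observedResidual_le (hJ : J.card ≤ N) (hσ : outerVariance ν J x ≠ 0) {r : ℝ}
    (hr : 0 < r) (hr1 : r ≤ 1) :
    (sampleLaw ν N M).real {p | observedResidual J x p
        ≤ r * ((N - J.card : ℕ) * outerVariance ν J x)}
      ≤ Real.exp (-((N - J.card : ℕ) * rate r)) := by
  refine measureReal_observedResidual_mem_le hJ x ν measurableSet_Iic fun K hK => ?_
  rw [← hK]
  exact measureReal_norm_starProjection_sq_le K hσ hr hr1

lemma measureReal_abs_observedResidual_sub (hJ : J.card ≤ N) (hσ : outerVariance ν J x ≠ 0) {u : ℝ}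
    (hu : 0 ≤ u) (hu1 : u < 1) :
    (sampleLaw ν N M).real {p | u * ((N - J.card : ℕ) * outerVariance ν J x)
        ≤ |observedResidual J x p - (N - J.card : ℕ) * outerVariance ν J x|}
      ≤ 2 * Real.exp (-((N - J.card : ℕ) * (u ^ 2 / 6))) := by
  refine measureReal_observedResidual_mem_le hJ x ν (S := {a |
    u * ((N - J.card : ℕ) * outerVariance ν J x)
      ≤ |a - (N - J.card : ℕ) * outerVariance ν J x|})
    (measurableSet_le measurable_const (by fun_prop)) fun K hK => ?_
  rw [← hK]
  exact measureReal_abs_norm_starProjection_sq_sub K hσ hu hu1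

end ResidualLaw

section UnionBound

variable {N M : ℕ}

lemma errorProb_le_of_forall_mem {D : Decoder N M} {ν : ℝ} {x : Fin M → ℂ}
    {E : Set ((Fin N → Fin M → ℂ) × (Fin N → ℂ))} (hE : MeasurableSet E)
    (h : ∀ᵐ A ∂matrixLaw N M, ∀ n,
      D (Matrix.of A) (observation (Matrix.of A) x n) ≠ some (supp x) → (A, n) ∈ E) :
    errorProb D ν x ≤ sampleLaw ν N M E :=
  calc errorProb D ν x ≤ ∫⁻ A, gaussianVector (Fin N) (Real.toNNReal (ν ^ 2)) (Prod.mk A ⁻¹' E)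
        ∂gaussianMatrix (Fin N) (Fin M) :=
        lintegral_mono_ae (h.mono fun _ hA => measure_mono hA)
    _ = sampleLaw ν N M E := (Measure.prod_apply hE).symm

lemma typicalityDecoder_eq_some {ν δ : ℝ} {L : ℕ} {A : Matrix (Fin N) (Fin M) ℂ}
    {y : Fin N → ℂ} {I : Finset (Fin M)} (hI : JointlyTypical ν δ L A y I)
    (h : ∀ J, J ≠ I → ¬ JointlyTypical ν δ L A y J) :
    typicalityDecoder N M ν δ L A y = some I := by
  have h_unique : ∃! J : Finset (Fin M), JointlyTypical ν δ L A y J :=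
    ⟨I, hI, fun J hJ => by_contra fun hne => h J hne hJ⟩
  rw [typicalityDecoder, dif_pos h_unique]
  exact congrArg some (h_unique.unique h_unique.choose_spec.1 hI)

lemma jointlyTypical_threshold_iff {ν ζ μ : ℝ} {L : ℕ} (hN : 0 < N) (hL : L ≤ N)
    {A : Matrix (Fin N) (Fin M) ℂ} {y : Fin N → ℂ} {J : Finset (Fin M)} :
    JointlyTypical ν (threshold ζ μ N L) L A y J ↔ J.card = L ∧ (columns A J).rank = L ∧
      |residual A J y - (N - L : ℕ) * ν ^ 2| < (N - L : ℕ) * (ζ * μ ^ 2) := by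
  have hN' : (0 : ℝ) < N := Nat.cast_pos.2 hN
  have h_center : 1 / (N : ℝ) * residual A J y - ((N : ℝ) - L) / N * ν ^ 2
      = (residual A J y - (N - L : ℕ) * ν ^ 2) / N := by rw [Nat.cast_sub hL]; ring
  have h_threshold : threshold ζ μ N L = (N - L : ℕ) * (ζ * μ ^ 2) / N := by
    rw [threshold, Nat.cast_sub hL]; ring
  rw [JointlyTypical, h_center, h_threshold, abs_div, abs_of_pos hN',
    div_lt_div_iff_of_pos_right hN']

lemma mem_supp {x : Fin M → ℂ} {i : Fin M} : i ∈ supp x ↔ x i ≠ 0 := by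
  simp [supp]

lemma minAbs_nonneg (x : Fin M → ℂ) : 0 ≤ minAbs x :=
  Real.iInf_nonneg fun _ => norm_nonneg _

lemma minAbs_le {x : Fin M → ℂ} {i : Fin M} (hi : i ∈ supp x) : minAbs x ≤ ‖x i‖ :=
  ciInf_le (f := fun i : supp x => ‖x i‖) (Set.finite_range _).bddBelow ⟨i, hi⟩

lemma coe_outerVariance (ν : ℝ) (J : Finset (Fin M)) (x : Fin M → ℂ) :
    (outerVariance ν J x : ℝ) = ν ^ 2 + ∑ i ∈ Jᶜ, ‖x i‖ ^ 2 := by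
  rw [outerVariance, NNReal.coe_add, Real.coe_toNNReal _ (sq_nonneg ν), add_comm]
  push_cast
  rfl

lemma outerVariance_supp (ν : ℝ) (x : Fin M → ℂ) : (outerVariance ν (supp x) x : ℝ) = ν ^ 2 := by
  rw [coe_outerVariance, Finset.sum_eq_zero, add_zero]
  intro i hi
  have : x i = 0 := by simpa [mem_supp] using hi
  simp [this]

lemma outerVariance_ne_zero {ν : ℝ} (hν : 0 < ν) (J : Finset (Fin M)) (x : Fin M → ℂ) :
    outerVariance ν J x ≠ 0 := by
  have : (0 : ℝ) < outerVariance ν J x := by rw [coe_outerVariance]; positivity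
  exact NNReal.coe_ne_zero.1 this.ne'

lemma le_outerVariance (ν : ℝ) (J : Finset (Fin M)) (x : Fin M → ℂ) :
    ν ^ 2 + (supp x \ J).card * minAbs x ^ 2 ≤ outerVariance ν J x := by
  rw [coe_outerVariance, ← nsmul_eq_mul]
  gcongr
  calc (supp x \ J).card • minAbs x ^ 2 ≤ ∑ i ∈ supp x \ J, ‖x i‖ ^ 2 :=
        Finset.card_nsmul_le_sum _ _ _ fun i hi =>
          pow_le_pow_left₀ (minAbs_nonneg x) (minAbs_le (Finset.mem_sdiff.1 hi).1) 2
    _ ≤ ∑ i ∈ Jᶜ, ‖x i‖ ^ 2 :=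
        Finset.sum_le_sum_of_subset_of_nonneg
          (fun i hi => Finset.mem_compl.2 (Finset.mem_sdiff.1 hi).2) fun i _ _ => by positivity

/-- The ratio between the acceptance level `ν² + ζ μ²` of the decoder and the smallest possible
variance `ν² + k μ²` outside a set of columns that misses `k` elements of the support. -/
def levelRatio (ν ζ μ : ℝ) (k : ℕ) : ℝ := (ν ^ 2 + ζ * μ ^ 2) / (ν ^ 2 + k * μ ^ 2)

lemma levelRatio_pos {ν ζ : ℝ} (hν : 0 < ν) (hζ : 0 < ζ) (μ : ℝ) (k : ℕ) :
    0 < levelRatio ν ζ μ k := by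
  unfold levelRatio
  positivity

lemma levelRatio_le_one {ν ζ : ℝ} (hν : 0 < ν) (hζ1 : ζ < 1) (μ : ℝ) {k : ℕ}
    (hk : 1 ≤ k) : levelRatio ν ζ μ k ≤ 1 := by
  have hζk : ζ ≤ k := hζ1.le.trans (Nat.one_le_cast.2 hk)
  rw [levelRatio, div_le_one (by positivity)]
  gcongr

lemma le_levelRatio_mul_outerVariance {ν ζ : ℝ} (hν : 0 < ν) (hζ : 0 < ζ) (J : Finset (Fin M))
    (x : Fin M → ℂ) :
    ν ^ 2 + ζ * minAbs x ^ 2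
      ≤ levelRatio ν ζ (minAbs x) (supp x \ J).card * outerVariance ν J x := by
  have h_pos : 0 < ν ^ 2 + (supp x \ J).card * minAbs x ^ 2 := by positivity
  calc ν ^ 2 + ζ * minAbs x ^ 2
      = levelRatio ν ζ (minAbs x) (supp x \ J).card
          * (ν ^ 2 + (supp x \ J).card * minAbs x ^ 2) := by
        rw [levelRatio, div_mul_cancel₀ _ h_pos.ne']
    _ ≤ _ := mul_le_mul_of_nonneg_left (le_outerVariance ν J x) (levelRatio_pos hν hζ _ _).le

/-- The competitors of the support `I` for the decoder: the other sets with `|I|` elements. -/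
def competitors {α : Type*} [Fintype α] [DecidableEq α] (I : Finset α) : Finset (Finset α) :=
  (Finset.univ.powersetCard I.card).erase I

lemma mem_competitors {α : Type*} [Fintype α] [DecidableEq α] {I J : Finset α} :
    J ∈ competitors I ↔ J ≠ I ∧ J.card = I.card := by
  simp [competitors]

lemma one_le_card_sdiff_of_mem_competitors {α : Type*} [Fintype α] [DecidableEq α]
    {I J : Finset α} (hJ : J ∈ competitors I) : 1 ≤ (I \ J).card := by
  obtain ⟨h_ne, h_card⟩ := mem_competitors.1 hJ
  rw [Finset.one_le_card, Finset.sdiff_nonempty]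
  exact fun h => h_ne (Finset.eq_of_subset_of_card_le h h_card.le).symm

lemma errorProb_typicalityDecoder_le_add_sum {ν ζ : ℝ} {x : Fin M → ℂ} (hN : (supp x).card < N) :
    errorProb (typicalityDecoder N M ν (threshold ζ (minAbs x) N (supp x).card) (supp x).card) ν x
      ≤ ENNReal.ofReal ((sampleLaw ν N M).real {p | (N - (supp x).card : ℕ) * (ζ * minAbs x ^ 2)
            ≤ |observedResidual (supp x) x p - (N - (supp x).card : ℕ) * ν ^ 2|}
          + ∑ J ∈ competitors (supp x), (sampleLaw ν N M).real {p | observedResidual J x p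
            ≤ (N - (supp x).card : ℕ) * (ν ^ 2 + ζ * minAbs x ^ 2)}) := by
  set I := supp x
  set d : ℝ := ((N - I.card : ℕ) : ℝ)
  let atypical : Set ((Fin N → Fin M → ℂ) × (Fin N → ℂ)) :=
    {p | d * (ζ * minAbs x ^ 2) ≤ |observedResidual I x p - d * ν ^ 2|}
  let accepts (J : Finset (Fin M)) : Set ((Fin N → Fin M → ℂ) × (Fin N → ℂ)) :=
    {p | observedResidual J x p ≤ d * (ν ^ 2 + ζ * minAbs x ^ 2)}
  have h_meas : MeasurableSet (atypical ∪ ⋃ J ∈ competitors I, accepts J) :=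
    (measurableSet_le measurable_const (((measurable_observedResidual I x).sub_const _).abs)).union
      (Finset.measurableSet_biUnion _ fun J _ =>
        measurableSet_le (measurable_observedResidual J x) measurable_const)
  refine (errorProb_le_of_forall_mem h_meas ?_).trans ?_
  · filter_upwards [ae_rank_columns hN.le] with A hA n h_error
    by_contra h_notMem
    simp only [Set.mem_union, Set.mem_iUnion, not_or, not_exists] at h_notMem
    refine h_error (typicalityDecoder_eq_some ?_ fun J hJ h_typical => ?_)
    · exact (jointlyTypical_threshold_iff (Nat.zero_lt_of_lt hN) hN.le).2
        ⟨rfl, hA, not_le.1 h_notMem.1⟩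
    · obtain ⟨h_card, -, h_abs⟩ :=
        (jointlyTypical_threshold_iff (Nat.zero_lt_of_lt hN) hN.le).1 h_typical
      refine h_notMem.2 J (mem_competitors.2 ⟨hJ, h_card⟩) ?_
      change residual _ _ _ ≤ d * (ν ^ 2 + ζ * minAbs x ^ 2)
      linarith [(abs_lt.1 h_abs).2]
  · rw [← ofReal_measureReal]
    exact ENNReal.ofReal_le_ofReal ((measureReal_union_le _ _).trans
      (add_le_add le_rfl (measureReal_biUnion_finset_le _ _)))

lemma errorProb_typicalityDecoder_le {ν ζ u : ℝ} (hν : 0 < ν) (hζ : 0 < ζ) (hζ1 : ζ < 1)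
    {x : Fin M → ℂ} (hN : (supp x).card < N) (hu0 : 0 ≤ u) (hu1 : u < 1)
    (hu : u * ν ^ 2 ≤ ζ * minAbs x ^ 2) :
    errorProb (typicalityDecoder N M ν (threshold ζ (minAbs x) N (supp x).card) (supp x).card) ν x
      ≤ ENNReal.ofReal (2 * Real.exp (-((N - (supp x).card : ℕ) * (u ^ 2 / 6)))
          + ∑ J ∈ competitors (supp x), Real.exp (-((N - (supp x).card : ℕ) *
            rate (levelRatio ν ζ (minAbs x) (supp x \ J).card)))) := by
  refine (errorProb_typicalityDecoder_le_add_sum hN).trans (ENNReal.ofReal_le_ofReal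
    (add_le_add ?_ (Finset.sum_le_sum fun J hJ => ?_)))
  · refine le_trans (measureReal_mono (Set.ofPred_subset_ofPred.2 fun p hp => ?_))
      (measureReal_abs_observedResidual_sub hN.le (outerVariance_ne_zero hν (supp x) x) hu0 hu1)
    rw [outerVariance_supp]
    refine le_trans ?_ hp
    rw [mul_left_comm]
    gcongr
  · have h_card := (mem_competitors.1 hJ).2
    have h_missing := one_le_card_sdiff_of_mem_competitors hJ
    rw [← h_card] at hN ⊢
    refine le_trans (measureReal_mono (Set.ofPred_subset_ofPred.2 fun p hp => ?_))
      (measureReal_observedResidual_le hN.le (outerVariance_ne_zero hν J x)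
        (levelRatio_pos hν hζ _ _) (levelRatio_le_one hν hζ1 (minAbs x) h_missing))
    refine le_trans hp ?_
    rw [mul_left_comm]
    gcongr
    exact le_levelRatio_mul_outerVariance hν hζ J x

end UnionBound

section Counting

variable {α : Type*} [Fintype α] [DecidableEq α]

lemma card_filter_competitors_le_pow (I : Finset α) (k : ℕ) :
    ((competitors I).filter fun J => (I \ J).card = k).card ≤ Fintype.card α ^ (2 * k) := by
  let kSubsets : Finset (Finset α) := Finset.univ.powersetCard k
  have h_card : kSubsets.card ≤ Fintype.card α ^ k := by
    rw [Finset.card_powersetCard, Finset.card_univ]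
    exact Nat.choose_le_pow _ _
  calc _ ≤ (kSubsets ×ˢ kSubsets).card := by
        refine Finset.card_le_card_of_injOn (fun J => (I \ J, J \ I)) (fun J hJ => ?_) ?_
        · obtain ⟨h_mem, rfl⟩ := Finset.mem_filter.1 (Finset.mem_coe.1 hJ)
          simp [kSubsets, Finset.card_sdiff_comm (mem_competitors.1 h_mem).2]
        · intro J _ J' _ h
          obtain ⟨h_lost, h_gained⟩ := Prod.ext_iff.1 h
          simp only [Finset.ext_iff, Finset.mem_sdiff] at h_lost h_gained ⊢
          grind
    _ = kSubsets.card * kSubsets.card := Finset.card_product _ _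
    _ ≤ Fintype.card α ^ (2 * k) := by
        rw [two_mul, pow_add]
        gcongr

lemma card_competitors_le_two_pow (I : Finset α) :
    (competitors I).card ≤ 2 ^ Fintype.card α := by
  rw [← Fintype.card_finset]
  exact Finset.card_le_univ _

lemma sum_competitors_le (I : Finset α) {f : ℕ → ℝ} (hf : ∀ k, 0 ≤ f k) :
    ∑ J ∈ competitors I, f (I \ J).card
      ≤ ∑ k ∈ Finset.Icc 1 I.card,
          min ((Fintype.card α : ℝ) ^ (2 * k)) (2 ^ Fintype.card α) * f k := by
  have h_mem : ∀ J ∈ competitors I, (I \ J).card ∈ Finset.Icc 1 I.card := fun J hJ =>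
    Finset.mem_Icc.2 ⟨one_le_card_sdiff_of_mem_competitors hJ,
      Finset.card_le_card Finset.sdiff_subset⟩
  rw [← Finset.sum_fiberwise_of_maps_to' h_mem]
  refine Finset.sum_le_sum fun k _ => ?_
  rw [Finset.sum_const, nsmul_eq_mul]
  gcongr
  · exact hf k
  · refine le_min ?_ ?_
    · exact_mod_cast card_filter_competitors_le_pow I k
    · exact_mod_cast (Finset.card_filter_le _ _).trans (card_competitors_le_two_pow I)

end Counting

section LevelRatio

variable {ν ζ μ : ℝ} {k : ℕ}

lemma le_one_sub_levelRatio (hν : 0 < ν) (hζ : 0 < ζ) (hk : 1 ≤ k) :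
    (1 - ζ) * (k * μ ^ 2 / (ν ^ 2 + k * μ ^ 2)) ≤ 1 - levelRatio ν ζ μ k := by
  have h_pos : 0 < ν ^ 2 + k * μ ^ 2 := by positivity
  have h_scale : ζ * μ ^ 2 ≤ k * (ζ * μ ^ 2) :=
    le_mul_of_one_le_left (by positivity) (Nat.one_le_cast.2 hk)
  rw [levelRatio, one_sub_div h_pos.ne', ← mul_div_assoc]
  gcongr
  linarith

lemma min_div_four_le_sq_div_add {t v : ℝ} (ht : 0 ≤ t) (hv : 0 < v) :
    min (t ^ 2 / v ^ 2) 1 / 4 ≤ (t / (v + t)) ^ 2 := by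
  rw [div_pow, div_le_div_iff₀ (by norm_num) (by positivity)]
  rcases le_total t v with h | h
  · calc min (t ^ 2 / v ^ 2) 1 * (v + t) ^ 2 ≤ t ^ 2 / v ^ 2 * (2 * v) ^ 2 := by
          gcongr
          · exact min_le_left _ _
          · linarith
      _ = t ^ 2 * 4 := by field_simp; norm_num
  · calc min (t ^ 2 / v ^ 2) 1 * (v + t) ^ 2 ≤ 1 * (2 * t) ^ 2 := by
          gcongr
          · exact min_le_right _ _
          · linarith
      _ = t ^ 2 * 4 := by ring

lemma le_rate_levelRatio (hν : 0 < ν) (hζ : 0 < ζ) (hζ1 : ζ < 1) (hk : 1 ≤ k) :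
    (1 - ζ) ^ 2 / 24 * min (k * μ ^ 4 / ν ^ 4) 1 ≤ rate (levelRatio ν ζ μ k) := by
  have hk' : (1 : ℝ) ≤ k := Nat.one_le_cast.2 hk
  have h_gap := le_one_sub_levelRatio (μ := μ) hν hζ hk
  have h_sq : k * μ ^ 4 ≤ (k * μ ^ 2) ^ 2 := by
    have : 0 ≤ (k - 1) * (k * μ ^ 4) := mul_nonneg (by linarith) (by positivity)
    linarith
  calc (1 - ζ) ^ 2 / 24 * min (k * μ ^ 4 / ν ^ 4) 1
      ≤ (1 - ζ) ^ 2 / 24 * min ((k * μ ^ 2) ^ 2 / (ν ^ 2) ^ 2) 1 := by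
        rw [← pow_mul ν]
        gcongr
    _ = (1 - ζ) ^ 2 / 6 * (min ((k * μ ^ 2) ^ 2 / (ν ^ 2) ^ 2) 1 / 4) := by ring
    _ ≤ (1 - ζ) ^ 2 / 6 * (k * μ ^ 2 / (ν ^ 2 + k * μ ^ 2)) ^ 2 := by
        gcongr
        exact min_div_four_le_sq_div_add (by positivity) (by positivity)
    _ = ((1 - ζ) * (k * μ ^ 2 / (ν ^ 2 + k * μ ^ 2))) ^ 2 / 6 := by ring
    _ ≤ (1 - levelRatio ν ζ μ k) ^ 2 / 6 := by
        have : 0 ≤ 1 - ζ := by linarith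
        gcongr
    _ = (levelRatio ν ζ μ k - 1) ^ 2 / 6 := by ring
    _ ≤ rate (levelRatio ν ζ μ k) := sq_sub_one_div_six_le_rate (levelRatio_pos hν hζ μ k)
        ((levelRatio_le_one hν hζ1 μ hk).trans one_le_two)

lemma levelRatio_le_inv {E : ℝ} (hν : 0 < ν) (hζ1 : ζ < 1) (hE : 0 < E) (hk : 2 * E ≤ k)
    (hkμ : 2 * E * ν ^ 2 ≤ k * μ ^ 2) : levelRatio ν ζ μ k ≤ E⁻¹ := by
  have hζE : E * ζ ≤ E * 1 := by gcongr
  have hμ : E * ζ * μ ^ 2 ≤ k / 2 * μ ^ 2 := by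
    gcongr
    linarith
  rw [levelRatio, div_le_iff₀ (by positivity), ← div_eq_inv_mul, le_div_iff₀' hE]
  linarith [sq_nonneg ν]

variable {T ℓ L : ℝ}

lemma le_mul_rate_levelRatio (hν : 0 < ν) (hζ : 0 < ζ) (hζ1 : ζ < 1) (hk : 1 ≤ k) (hL : 0 ≤ L)
    (h_signal : T * ν ^ 4 * ℓ ≤ L * μ ^ 4) (h_few : T * k * ℓ ≤ L) :
    (1 - ζ) ^ 2 / 24 * (T * k * ℓ) ≤ L * rate (levelRatio ν ζ μ k) := by
  have h_min : T * k * ℓ ≤ L * min (k * μ ^ 4 / ν ^ 4) 1 := by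
    rw [mul_min_of_nonneg _ _ hL, mul_one]
    refine le_min ?_ h_few
    rw [← mul_div_assoc, le_div_iff₀ (by positivity)]
    calc T * k * ℓ * ν ^ 4 = k * (T * ν ^ 4 * ℓ) := by ring
      _ ≤ k * (L * μ ^ 4) := by gcongr
      _ = L * (k * μ ^ 4) := by ring
  calc _ ≤ (1 - ζ) ^ 2 / 24 * (L * min (k * μ ^ 4 / ν ^ 4) 1) := by gcongr
    _ = L * ((1 - ζ) ^ 2 / 24 * min (k * μ ^ 4 / ν ^ 4) 1) := by ring
    _ ≤ _ := mul_le_mul_of_nonneg_left (le_rate_levelRatio hν hζ hζ1 hk) hL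

lemma log_sub_one_le_rate_levelRatio {E : ℝ} (hν : 0 < ν) (hζ : 0 < ζ) (hζ1 : ζ < 1) (hE : 0 < E)
    (hk : 1 ≤ k) (hT : 0 < T) (hℓ : 0 < ℓ) (h_many : L < T * k * ℓ)
    (h_dim : 2 * E * T * ℓ ≤ L) (h_signal : T * (2 * E * ν ^ 2) ^ 2 * ℓ ≤ L * μ ^ 4) :
    Real.log E - 1 ≤ rate (levelRatio ν ζ μ k) := by
  have hk' : (1 : ℝ) ≤ k := Nat.one_le_cast.2 hk
  have hTℓ : 0 < T * ℓ := mul_pos hT hℓ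
  have hEk : 2 * E ≤ k := by
    refine le_of_mul_le_mul_left ?_ hTℓ
    linarith
  have hEμ : (2 * E * ν ^ 2) ^ 2 ≤ (k * μ ^ 2) ^ 2 := by
    refine le_of_mul_le_mul_left ?_ hTℓ
    calc T * ℓ * (2 * E * ν ^ 2) ^ 2 = T * (2 * E * ν ^ 2) ^ 2 * ℓ := by ring
      _ ≤ L * μ ^ 4 := h_signal
      _ ≤ T * k * ℓ * (k * μ ^ 4) := by
          gcongr
          exact le_mul_of_one_le_left (by positivity) hk'
      _ = T * ℓ * (k * μ ^ 2) ^ 2 := by ring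
  exact log_sub_one_le_rate (levelRatio_pos hν hζ μ k)
    (levelRatio_le_inv hν hζ1 hE hEk (le_of_sq_le_sq hEμ (by positivity)))

end LevelRatio

section Asymptotics

lemma mul_exp_neg_le_inv {a b r : ℝ} (hb : 0 < b) (h : a * b ≤ Real.exp r) :
    a * Real.exp (-r) ≤ b⁻¹ := by
  rwa [Real.exp_neg, ← div_eq_mul_inv, div_le_iff₀ (Real.exp_pos r), ← div_eq_inv_mul,
    le_div_iff₀ hb]

lemma pow_mul_exp_neg_le_inv_pow {m L r : ℝ} {k n : ℕ} (hm : 0 ≤ m) (hL : 1 ≤ L) (hmL : m ≤ L ^ 2)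
    (hk : 1 ≤ k) (h : k * ((n + 4) * Real.log L) ≤ r) :
    m ^ (2 * k) * Real.exp (-r) ≤ (L ^ n)⁻¹ := by
  have hL0 : 0 < L := by positivity
  refine mul_exp_neg_le_inv (by positivity) ?_
  calc m ^ (2 * k) * L ^ n ≤ (L ^ 2) ^ (2 * k) * L ^ (k * n) := by
        gcongr
        exact Nat.le_mul_of_pos_left n hk
    _ = L ^ (k * (n + 4)) := by rw [← pow_mul, ← pow_add]; congr 1; ring
    _ = Real.exp (k * ((n + 4) * Real.log L)) := by
        rw [← Real.exp_log (pow_pos hL0 _), Real.log_pow, ← mul_assoc]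
        push_cast
        rfl
    _ ≤ Real.exp r := Real.exp_le_exp.2 h

lemma two_pow_mul_exp_neg_le_inv_pow {M n : ℕ} {L r : ℝ} (hL : 0 < L)
    (h : M + n * Real.log L ≤ r) : 2 ^ M * Real.exp (-r) ≤ (L ^ n)⁻¹ := by
  refine mul_exp_neg_le_inv (by positivity) ?_
  have h_two : (2 : ℝ) ≤ Real.exp 1 := by linarith [Real.add_one_le_exp 1]
  calc 2 ^ M * L ^ n ≤ Real.exp 1 ^ M * L ^ n := by gcongr
    _ = Real.exp (M + n * Real.log L) := by
        rw [Real.exp_add, ← Real.exp_nat_mul, mul_one, Real.exp_nat_mul, Real.exp_log hL]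
    _ ≤ Real.exp r := Real.exp_le_exp.2 h

lemma tendsto_natCast_atTop_of_isBigO {L : ℕ → ℕ}
    (hL : (fun M : ℕ => (M : ℝ)) =O[atTop] fun M => (L M : ℝ)) :
    Tendsto (fun M => (L M : ℝ)) atTop atTop := by
  simpa only [Real.norm_natCast] using Asymptotics.IsBigO.trans_tendsto_norm_atTop hL
    (by simpa only [Real.norm_natCast] using tendsto_natCast_atTop_atTop)

variable {L : ℕ → ℕ}

lemma eventually_mul_log_le (hL : Tendsto (fun M => (L M : ℝ)) atTop atTop) (W : ℝ) :
    ∀ᶠ M in atTop, W * Real.log (L M) ≤ L M := by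
  have h_little := (Real.isLittleO_log_id_atTop.comp_tendsto hL).const_mul_left W
  filter_upwards [h_little.def one_pos] with M hM
  simpa using (le_abs_self _).trans hM

lemma eventually_mul_log_le_of_tendsto_div {f : ℕ → ℝ}
    (hL : Tendsto (fun M => (L M : ℝ)) atTop atTop)
    (hf : Tendsto (fun M => f M / Real.log (L M)) atTop atTop) (W : ℝ) :
    ∀ᶠ M in atTop, W * Real.log (L M) ≤ f M := by
  filter_upwards [hf.eventually_ge_atTop W, hL.eventually_gt_atTop 1] with M hM hLM
  exact (le_div_iff₀ (Real.log_pos hLM)).1 hM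

variable {μ d : ℕ → ℝ} {ν ζ c : ℝ}

lemma eventually_exp_neg_le_inv_pow (hν : 0 < ν) (hζ : 0 < ζ) (hc : 0 < c)
    (hL : Tendsto (fun M => (L M : ℝ)) atTop atTop)
    (hμ : Tendsto (fun M => (L M : ℝ) * μ M ^ 4 / Real.log (L M)) atTop atTop)
    (hd : ∀ᶠ M in atTop, c * L M ≤ d M) (n : ℕ) :
    ∀ᶠ M in atTop, Real.exp (-(d M * (min (ζ * μ M ^ 2 / ν ^ 2) (1 / 2) ^ 2 / 6)))
      ≤ ((L M : ℝ) ^ n)⁻¹ := by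
  filter_upwards [eventually_mul_log_le hL (4 * (6 * n / c)),
    eventually_mul_log_le_of_tendsto_div hL hμ (6 * n / c * ν ^ 4 / ζ ^ 2),
    hL.eventually_gt_atTop 1, hd] with M h_dim h_signal hL1 hdM
  have hL0 : (0 : ℝ) < L M := by linarith
  have h_sq : 6 * n / c * Real.log (L M) ≤ L M * min (ζ * μ M ^ 2 / ν ^ 2) (1 / 2) ^ 2 := by
    rcases min_choice (ζ * μ M ^ 2 / ν ^ 2) (1 / 2) with h | h
    · rw [h]
      field_simp at h_signal ⊢
      linarith
    · rw [h]
      linarith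
  have h_exponent : n * Real.log (L M) ≤ d M * (min (ζ * μ M ^ 2 / ν ^ 2) (1 / 2) ^ 2 / 6) :=
    calc n * Real.log (L M) = c / 6 * (6 * n / c * Real.log (L M)) := by field_simp
      _ ≤ c / 6 * (L M * min (ζ * μ M ^ 2 / ν ^ 2) (1 / 2) ^ 2) := by gcongr
      _ = c * L M * (min (ζ * μ M ^ 2 / ν ^ 2) (1 / 2) ^ 2 / 6) := by ring
      _ ≤ _ := by gcongr
  calc _ ≤ Real.exp (-(n * Real.log (L M))) := by gcongr
    _ = ((L M : ℝ) ^ n)⁻¹ := by rw [Real.exp_neg, Real.exp_nat_mul, Real.exp_log hL0]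

-- Sets missing few elements of the support are counted by `M ^ (2k)` and beaten by the quadratic
-- lower bound on the rate; sets missing many are counted by `2 ^ M`, but for them the rate exceeds
-- any prescribed constant.
lemma eventually_forall_min_mul_exp_neg_le_inv_pow (hν : 0 < ν) (hζ : 0 < ζ) (hζ1 : ζ < 1)
    (hc : 0 < c) (hL : (fun M : ℕ => (M : ℝ)) =O[atTop] fun M => (L M : ℝ))
    (hμ : Tendsto (fun M => (L M : ℝ) * μ M ^ 4 / Real.log (L M)) atTop atTop)
    (hd : ∀ᶠ M in atTop, c * L M ≤ d M) (n : ℕ) :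
    ∀ᶠ M : ℕ in atTop, ∀ k, 1 ≤ k → min ((M : ℝ) ^ (2 * k)) (2 ^ M)
      * Real.exp (-(d M * rate (levelRatio ν ζ (μ M) k))) ≤ ((L M : ℝ) ^ n)⁻¹ := by
  obtain ⟨K, h_bigO⟩ := hL.bound
  have hL' := tendsto_natCast_atTop_of_isBigO hL
  have hζ1' : 0 < 1 - ζ := sub_pos.2 hζ1
  set T := (n + 4) / (c * ((1 - ζ) ^ 2 / 24)) with hT
  have hT0 : 0 < T := by positivity
  set E := Real.exp ((K + 1) / c + 1)
  have hE0 : 0 < E := Real.exp_pos _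
  have h_dim := eventually_mul_log_le hL'
  have h_signal := eventually_mul_log_le_of_tendsto_div hL' hμ
  filter_upwards [h_bigO, hL'.eventually_ge_atTop K, hL'.eventually_gt_atTop 1, hd,
    h_dim (2 * E * T), h_dim n, h_signal (T * ν ^ 4), h_signal (T * (2 * E * ν ^ 2) ^ 2)]
    with M hMK hKL hL1 hdM h_dimE h_dimn h_signalν h_signalE k hk
  rw [Real.norm_natCast, Real.norm_natCast] at hMK
  have hL0 : (0 : ℝ) < L M := by linarith
  have h_log : 0 < Real.log (L M) := Real.log_pos hL1
  have h_rate : 0 ≤ rate (levelRatio ν ζ (μ M) k) :=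
    (sq_nonneg _).trans (sq_sqrt_sub_one_le_rate (levelRatio_pos hν hζ _ _))
  have h_exponent : c * (L M * rate (levelRatio ν ζ (μ M) k))
      ≤ d M * rate (levelRatio ν ζ (μ M) k) := by
    rw [← mul_assoc]
    gcongr
  rcases le_or_gt (T * k * Real.log (L M)) (L M) with h_few | h_many
  · refine (mul_le_mul_of_nonneg_right (min_le_left _ _) (Real.exp_nonneg _)).trans
      (pow_mul_exp_neg_le_inv_pow (Nat.cast_nonneg M) hL1.le (by nlinarith) hk ?_)
    refine le_trans ?_ h_exponent
    calc k * ((n + 4) * Real.log (L M))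
        = c * ((1 - ζ) ^ 2 / 24 * (T * k * Real.log (L M))) := by rw [hT]; field_simp
      _ ≤ _ := mul_le_mul_of_nonneg_left
        (le_mul_rate_levelRatio hν hζ hζ1 hk hL0.le h_signalν h_few) hc.le
  · refine (mul_le_mul_of_nonneg_right (min_le_right _ _) (Real.exp_nonneg _)).trans
      (two_pow_mul_exp_neg_le_inv_pow hL0 ?_)
    have h_large := log_sub_one_le_rate_levelRatio hν hζ hζ1 hE0 hk hT0 h_log h_many h_dimE
      h_signalE
    refine le_trans ?_ h_exponent
    calc M + n * Real.log (L M) ≤ K * L M + L M := add_le_add hMK h_dimn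
      _ = c * (L M * (Real.log E - 1)) := by rw [Real.log_exp]; field_simp; ring
      _ ≤ _ := by gcongr

end Asymptotics

section Reliability

lemma two_mul_add_sum_Icc_le {L n : ℕ} (hL : 2 ≤ L) {a : ℝ} {b : ℕ → ℝ}
    (ha : a ≤ ((L : ℝ) ^ (n + 2))⁻¹) (hb : ∀ k, 1 ≤ k → b k ≤ ((L : ℝ) ^ (n + 2))⁻¹) :
    2 * a + ∑ k ∈ Finset.Icc 1 L, b k ≤ ((L : ℝ) ^ n)⁻¹ := by
  have hL' : (2 : ℝ) ≤ L := Nat.ofNat_le_cast.2 hL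
  have h_sum := Finset.sum_le_card_nsmul (Finset.Icc 1 L) b _ fun k hk =>
    hb k (Finset.mem_Icc.1 hk).1
  rw [Nat.card_Icc, Nat.add_sub_cancel, nsmul_eq_mul] at h_sum
  calc 2 * a + ∑ k ∈ Finset.Icc 1 L, b k ≤ (2 + L) * ((L : ℝ) ^ (n + 2))⁻¹ := by linarith
    _ ≤ (L : ℝ) ^ 2 * ((L : ℝ) ^ (n + 2))⁻¹ := by
        gcongr
        nlinarith
    _ = ((L : ℝ) ^ n)⁻¹ := by rw [pow_add]; field_simp

lemma eventually_errorProb_le {L N : ℕ → ℕ} {ν ζ C : ℝ} (hν : 0 < ν) (hζ : 0 < ζ) (hζ1 : ζ < 1)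
    (hC : 1 < C) (hL : (fun M : ℕ => (M : ℝ)) =O[atTop] fun M => (L M : ℝ))
    {x : ∀ M, Fin M → ℂ} (hx : ∀ M, (supp (x M)).card = L M)
    (hμ : Tendsto (fun M => (L M : ℝ) * minAbs (x M) ^ 4 / Real.log (L M)) atTop atTop)
    (hN : ∀ᶠ M in atTop, C * L M ≤ N M) (n : ℕ) :
    ∀ᶠ M in atTop, errorProb (typicalityDecoder (N M) M ν
      (threshold ζ (minAbs (x M)) (N M) (L M)) (L M)) ν (x M)
        ≤ ENNReal.ofReal ((L M : ℝ) ^ n)⁻¹ := by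
  have hC' : 0 < C - 1 := sub_pos.2 hC
  have hL' := tendsto_natCast_atTop_of_isBigO hL
  have h_lt : ∀ᶠ M in atTop, L M < N M := by
    filter_upwards [hN, hL'.eventually_gt_atTop 0] with M hM hLM
    exact_mod_cast (lt_mul_of_one_lt_left hLM hC).trans_le hM
  have h_codim : ∀ᶠ M in atTop, (C - 1) * L M ≤ (N M - L M : ℕ) := by
    filter_upwards [hN, h_lt] with M hM hLN
    rw [Nat.cast_sub hLN.le]
    linarith
  filter_upwards [h_lt, hL'.eventually_ge_atTop 2,
    eventually_exp_neg_le_inv_pow hν hζ hC' hL' hμ h_codim (n + 2),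
    eventually_forall_min_mul_exp_neg_le_inv_pow hν hζ hζ1 hC' hL hμ h_codim (n + 2)]
    with M hLN hL2 h_atypical h_accepts
  set u := min (ζ * minAbs (x M) ^ 2 / ν ^ 2) (1 / 2)
  have hu : u * ν ^ 2 ≤ ζ * minAbs (x M) ^ 2 :=
    (le_div_iff₀ (by positivity)).1 (min_le_left _ _)
  have h_bound := errorProb_typicalityDecoder_le hν hζ hζ1 ((hx M).trans_lt hLN)
    (le_min (by positivity) (by norm_num)) ((min_le_right _ _).trans_lt one_half_lt_one) hu
  have h_count := sum_competitors_le (supp (x M)) fun k =>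
    (Real.exp_nonneg (-((N M - L M : ℕ) * rate (levelRatio ν ζ (minAbs (x M)) k))))
  rw [hx M] at h_bound h_count
  rw [Fintype.card_fin] at h_count
  exact h_bound.trans (ENNReal.ofReal_le_ofReal ((add_le_add le_rfl h_count).trans
    (two_mul_add_sum_Icc_le (Nat.ofNat_le_cast.1 hL2) h_atypical h_accepts)))

variable {p : ℕ → ℝ≥0∞} {ℓ : ℕ → ℝ}

lemma tendsto_zero_of_eventually_le_inv_pow (hℓ : Tendsto ℓ atTop atTop)
    (hp : ∀ᶠ M in atTop, p M ≤ ENNReal.ofReal (ℓ M)⁻¹) : Tendsto p atTop (𝓝 0) := by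
  refine tendsto_of_tendsto_of_tendsto_of_le_of_le' tendsto_const_nhds ?_
    (Eventually.of_forall fun _ => zero_le) hp
  simpa only [ENNReal.ofReal_zero, Function.comp_def] using
    ENNReal.tendsto_ofReal (tendsto_inv_atTop_zero.comp hℓ)

lemma natCast_le_neg_log_div_log {q : ℝ≥0∞} {t : ℝ} {n : ℕ} (ht : 1 < t)
    (hq : q ≤ ENNReal.ofReal (t ^ n)⁻¹) :
    ((n : ℝ) : EReal) ≤ -ENNReal.log q / ((Real.log t : ℝ) : EReal) := by
  have h_pow : 0 < (t ^ n)⁻¹ := inv_pos.2 (pow_pos (one_pos.trans ht) n)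
  rw [EReal.le_div_iff_mul_le (EReal.coe_pos.2 (Real.log_pos ht)) (EReal.coe_ne_top _),
    EReal.le_neg, ← EReal.coe_mul, ← EReal.coe_neg]
  refine (ENNReal.log_monotone hq).trans_eq ?_
  rw [ENNReal.log_ofReal_of_pos h_pow, Real.log_inv, Real.log_pow]

lemma tendsto_neg_log_div_log_nhds_top (hℓ : Tendsto ℓ atTop atTop)
    (hp : ∀ n : ℕ, ∀ᶠ M in atTop, p M ≤ ENNReal.ofReal (ℓ M ^ n)⁻¹) :
    Tendsto (fun M => -ENNReal.log (p M) / ((Real.log (ℓ M) : ℝ) : EReal)) atTop (𝓝 ⊤) := by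
  refine EReal.tendsto_nhds_top_iff_real.2 fun B => ?_
  obtain ⟨n, hn⟩ := exists_nat_gt B
  filter_upwards [hp n, hℓ.eventually_gt_atTop 1] with M hM hℓM
  exact (EReal.coe_lt_coe_iff.2 hn).trans_le (natCast_le_neg_log_div_log hℓM hM)

end Reliability

section Sparsity

variable {β : ℝ}

lemma isBigO_natCast_sparsity (hβ : 0 < β) :
    (fun M : ℕ => (M : ℝ)) =O[atTop] fun M => (sparsity β M : ℝ) := by
  refine Asymptotics.IsBigO.of_bound (2 * β) ?_
  filter_upwards [(tendsto_natCast_atTop_atTop (R := ℝ)).eventually_ge_atTop (2 * β)] with M hM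
  have h_floor := (div_lt_iff₀ hβ).1 (Nat.lt_floor_add_one ((M : ℝ) / β))
  rw [Real.norm_natCast, Real.norm_natCast, sparsity]
  linarith

lemma eventually_le_of_dominates {f g : ℕ → ℝ} (h : Dominates f g) : ∀ᶠ M in atTop, g M ≤ f M := by
  rcases h with h_zero | ⟨-, -, -, hg, M₀, h_lt⟩
  · exact Eventually.of_forall fun M => ((h_zero M).2.trans (h_zero M).1.symm).le
  · filter_upwards [eventually_gt_atTop M₀] with M hM
    exact ((one_lt_div_iff).1 (h_lt M hM)).elim (fun h => h.2.le) fun h => absurd h.1 (hg M).not_gt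

end Sparsity

end SparseRecovery

end

open SparseRecovery in
theorem theorem1_general {L N : ℕ → ℕ} {ν ζ C : ℝ} (hν : 0 < ν) (hζ : 0 < ζ) (hζ1 : ζ < 1)
    (hC : 1 < C) (hL : (fun M : ℕ => (M : ℝ)) =O[atTop] fun M => (L M : ℝ))
    {x : ∀ M, Fin M → ℂ} (hx : ∀ M, (supp (x M)).card = L M)
    (hμ : Tendsto (fun M => (L M : ℝ) * minAbs (x M) ^ 4 / Real.log (L M)) atTop atTop)
    (hN : ∀ᶠ M in atTop, C * L M ≤ N M) {D : ∀ M, Decoder (N M) M}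
    (hD : ∀ M, D M = typicalityDecoder (N M) M ν
      (threshold ζ (minAbs (x M)) (N M) (L M)) (L M)) :
    AsymptoticallyReliable D ν x ∧
      Tendsto (fun M => -ENNReal.log (errorProb (D M) ν (x M)) / ((Real.log (L M) : ℝ) : EReal))
        atTop (𝓝 ⊤) := by
  obtain rfl : D = _ := funext hD
  have h_decay := eventually_errorProb_le hν hζ hζ1 hC hL hx hμ hN
  have hL' := tendsto_natCast_atTop_of_isBigO hL
  exact ⟨tendsto_zero_of_eventually_le_inv_pow hL' (by simpa only [pow_one] using h_decay 1),
    tendsto_neg_log_div_log_nhds_top hL' h_decay⟩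

theorem theorem1 (β : ℝ) (hβ : 2 < β) :
    ∃ C₁ : ℝ, 1 < C₁ ∧
      ∀ (ν : ℝ), 0 < ν → ∀ (ζ : ℝ), 0 < ζ → ζ < 1 →
      ∀ (x : ∀ M : ℕ, Fin M → ℂ),
        (∀ M, (SparseRecovery.supp (x M)).card = SparseRecovery.sparsity β M) →
        Tendsto (fun M : ℕ => (SparseRecovery.sparsity β M : ℝ) *
            SparseRecovery.minAbs (x M) ^ 4 / Real.log (SparseRecovery.sparsity β M))
          atTop atTop →
      ∀ (N : ℕ → ℕ),
        SparseRecovery.Dominates (fun M => (N M : ℝ))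
          (fun M => C₁ * (SparseRecovery.sparsity β M : ℝ)) →
      ∀ (D : ∀ M, SparseRecovery.Decoder (N M) M),
        (∀ M, D M = SparseRecovery.typicalityDecoder (N M) M ν
          (SparseRecovery.threshold ζ (SparseRecovery.minAbs (x M)) (N M)
            (SparseRecovery.sparsity β M))
          (SparseRecovery.sparsity β M)) →
        SparseRecovery.AsymptoticallyReliable D ν x ∧
        Tendsto (fun M : ℕ => -ENNReal.log (SparseRecovery.errorProb (D M) ν (x M)) /
            ((Real.log (SparseRecovery.sparsity β M) : ℝ) : EReal))
          atTop (𝓝 ⊤) := by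
  refine ⟨2, one_lt_two, fun ν hν ζ hζ hζ1 x hx hμ N hN D hD => ?_⟩
  exact theorem1_general hν hζ hζ1 one_lt_two (SparseRecovery.isBigO_natCast_sparsity (by linarith))
    hx hμ (SparseRecovery.eventually_le_of_dominates hN) hD
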